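/- In the hard $k$-taxi problem on a metric space $(M,d)$, $k$ taxis start in a given initial configuration and must serve, in order, a sequence $\sigma$ of requests $(s,t)\in M^2$: some taxi has to move to $s$ and then to $t$. The cost is the total distance travelled by the taxis, except that the movement of the serving taxi from $s$ to $t$ is free. A deterministic online algorithm $A$ (which serves each request without knowing the later ones) is $\rho$-competitive if for every initial configuration there is a constant $c$, independent of $\sigma$, with $\mathrm{cost}_A(\sigma)\le\rho\,\mathrm{OPT}(\sigma)+c$ for all $\sigma$, where $\mathrm{OPT}$ is the optimal offline cost. The deterministic competitive ratio (on general metrics) is the infimum of all $\rho\in\mathbb R$ such that every metric space has a $\rho$-competitive deterministic online algorithm. The algorithm BiasedDC for two taxis is the following. The taxi that served the last request is called active (initially, either taxi), the other one passive. Upon a request $(s,t)$ both taxis move towards $s$ along shortest paths, the passive taxi at twice the speed of the active one, and both stop as soon as one of them reaches $s$; the taxi that has reached $s$ then carries the passenger to $t$. If a taxi stops on its way from its place $\ell$ to $s$ at distance $r$ from $\ell$, it stops at a point of $M$ that lies there on a shortest path, or else at a virtual point $v$ newly added to the metric space, with $d(v,x)=\min\{r+d(\ell,x),\ d(\ell,s)-r+d(s,x)\}$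 for $x\in M$. A taxi that stops at a virtual point in fact stays where it is, and only pretends to be at the virtual point when future moves are computed. Theorem. (a) On every metric space, and for every choice of the points of $M$ or virtual points at which the taxis stop, BiasedDC is $9$-competitive for the hard $2$-taxi problem. (b) The deterministic competitive ratio of the hard $2$-taxi problem on general metrics is exactly $9$. -/

import Mathlib

universe u

noncomputable section

namespace HardTaxi

/-- Positions of `k` taxis in `M`; the taxis carry names `0, …, k - 1`. -/
abbrev Config (M : Type u) (k : ℕ) : Type u := Fin k → M

/-- A request `(s, t)`: a passenger wants to travel from the start `s` to the destination `t`. -/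
abbrev Request (M : Type u) : Type u := M × M

/-- What is done upon one request: first every taxi `i` drives, without a passenger, to
`target i`; then the taxi `server`, which must now be at the start of the request, carries the
passenger to the destination. (Driving after the drop-off may be done upon the next request.) -/
structure Move (M : Type u) (k : ℕ) : Type u where
  target : Config M k
  server : Fin k

namespace Move

variable {M : Type u} {k : ℕ}

/-- The serving taxi has reached the start of the request. -/
def Serves (m : Move M k) (r : Request M) : Prop := m.target m.server = r.1

/-- The configuration after the serving taxi has carried the passenger to the destination. -/
def after (m : Move M k) (r : Request M) : Config M k := Function.update m.target m.server r.2

end Move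

/-- The cost, in the hard version, of serving `σ` by the given moves, starting from `C`: the
total distance driven without a passenger. -/
def scheduleCost {M : Type u} [MetricSpace M] {k : ℕ} :
    Config M k → List (Request M) → List (Move M k) → ℝ
  | C, r :: σ, m :: ms => (∑ i, dist (C i) (m.target i)) + scheduleCost (m.after r) σ ms
  | _, _, _ => 0

/-- The optimal offline cost of serving `σ` from the initial configuration `C`. -/
def opt {M : Type u} [MetricSpace M] {k : ℕ} (C : Config M k) (σ : List (Request M)) : ℝ :=
  sInf {x : ℝ | ∃ ms : List (Move M k), List.Forall₂ Move.Serves ms σ ∧ x = scheduleCost C σ ms}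

/-- A deterministic online algorithm for `k` taxis in `M`: `move C past r` is what it does upon
the request `r`, if `C` is the initial configuration and `past` is the list of the earlier
requests, oldest first. -/
structure OnlineAlgorithm (M : Type u) (k : ℕ) : Type u where
  move : Config M k → List (Request M) → Request M → Move M k
  serves : ∀ (C : Config M k) (past : List (Request M)) (r : Request M), (move C past r).Serves r

namespace OnlineAlgorithm

variable {M : Type u} {k : ℕ}

/-- The moves of `A` upon the requests of a list that comes after the list `past`. -/
def movesFrom (A : OnlineAlgorithm M k) (C : Config M k) :
    List (Request M) → List (Request M) → List (Move M k)
  | _, [] => []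
  | past, r :: σ => A.move C past r :: A.movesFrom C (past ++ [r]) σ

/-- The cost of `A` on the request sequence `σ` from the initial configuration `C`. -/
def cost [MetricSpace M] (A : OnlineAlgorithm M k) (C : Config M k) (σ : List (Request M)) : ℝ :=
  scheduleCost C σ (A.movesFrom C [] σ)

/-- `A` is `ρ`-competitive: its cost is at most `ρ` times the optimal cost, up to an additive
constant that does not depend on the request sequence. -/
def IsCompetitive [MetricSpace M] (A : OnlineAlgorithm M k) (ρ : ℝ) : Prop :=
  ∀ C : Config M k, ∃ c : ℝ, ∀ σ : List (Request M), A.cost C σ ≤ ρ * opt C σ + c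

end OnlineAlgorithm

/-- `r` is the deterministic competitive ratio of the hard `k`-taxi problem on general metrics:
the infimum of all `ρ` such that every metric space has a `ρ`-competitive deterministic online
algorithm. -/
def IsCompetitiveRatio (k : ℕ) (r : ℝ) : Prop :=
  IsGLB {ρ : ℝ | ∀ (M : Type u) [MetricSpace M],
    ∃ A : OnlineAlgorithm M k, A.IsCompetitive ρ} r

/-! ### The algorithm BiasedDC

A place where a taxi is, or pretends to be, is a point of `M` or a virtual point that has been
added to `M`. It is recorded by the function `f : M → ℝ` of its distances to the points of `M`
(`f = dist x` for a point `x` of `M`). -/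

/-- The distances to the points of `M` of a new point, put on a shortest path from a place `f` to
a point `s`, at distance `r` from `f` and `f s - r` from `s`: they are induced by the shortest
path through `f` or `s`. -/
def virtualPoint {M : Type u} [MetricSpace M] (f : M → ℝ) (s : M) (r : ℝ) : M → ℝ :=
  fun x => min (r + f x) (f s - r + dist s x)

/-- A choice of the points of `M` at which taxis can stop. If a taxi stops on its way from a place
`f` to a point `s` after the distance `r`, then `point f s r` is either a point of `M` that lies
there on a shortest path, or `none`, which means that a virtual point is added. -/
structure StopRule (M : Type u) [MetricSpace M] : Type u where
  point : (M → ℝ) → M → ℝ → Option M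
  on_path : ∀ (f : M → ℝ) (s : M) (r : ℝ) (z : M),
    point f s r = some z → f z = r ∧ dist z s = f s - r

/-- The choice to add a virtual point at every stop. -/
instance {M : Type u} [MetricSpace M] : Inhabited (StopRule M) :=
  ⟨⟨fun _ _ _ => none, fun _ _ _ _ h => nomatch h⟩⟩

/-- A taxi of BiasedDC: where it really is, and (by distances) where it pretends to be. -/
structure Taxi (M : Type u) : Type u where
  pos : M
  loc : M → ℝ

/-- A taxi that really is where it pretends to be. -/
def Taxi.at {M : Type u} [MetricSpace M] (x : M) : Taxi M := ⟨x, dist x⟩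

open Classical in
/-- A taxi moves the distance `r` towards `s` and stops. It ends up at `s` if it gets there. If it
stops earlier at a point of `M`, then it goes there. If it stops at a virtual point, then it stays
where it really is and pretends to be at the virtual point. -/
def Taxi.advance {M : Type u} [MetricSpace M] (R : StopRule M) (T : Taxi M) (s : M) (r : ℝ) :
    Taxi M :=
  if r = T.loc s then Taxi.at s
  else match R.point T.loc s r with
    | some z => Taxi.at z
    | none => ⟨T.pos, virtualPoint T.loc s r⟩

/-- The state of BiasedDC: the two taxis, and the name of the active one. -/
structure BiasedState (M : Type u) : Type u where
  taxi : Fin 2 → Taxi M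
  active : Fin 2

namespace BiasedState

variable {M : Type u} [MetricSpace M]

/-- The name of the taxi that is not active. -/
def passive (S : BiasedState M) : Fin 2 := 1 - S.active

/-- The time until one of the taxis reaches `s`, if the active taxi has speed `1` and the passive
taxi has speed `2`. -/
def time (S : BiasedState M) (s : M) : ℝ :=
  min ((S.taxi S.active).loc s) ((S.taxi S.passive).loc s / 2)

/-- The taxi that reaches `s` first (the passive one if they arrive together). -/
def first (S : BiasedState M) (s : M) : Fin 2 :=
  if (S.taxi S.passive).loc s / 2 ≤ (S.taxi S.active).loc s then S.passive else S.active

/-- Both taxis move towards `s`, the passive one at twice the speed of the active one, until one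
of them reaches `s`. -/
def approach (R : StopRule M) (S : BiasedState M) (s : M) : Fin 2 → Taxi M :=
  fun i => (S.taxi i).advance R s (if i = S.active then S.time s else 2 * S.time s)

/-- The state after the request `r`: the taxis have approached the start, and the one that reached
it has carried the passenger to the destination and is now the active one. -/
def next (R : StopRule M) (S : BiasedState M) (r : Request M) : BiasedState M where
  taxi := Function.update (S.approach R r.1) (S.first r.1) (Taxi.at r.2)
  active := S.first r.1

/-- The initial state: taxi `0` is taken to be the active one. -/
def init (C : Config M 2) : BiasedState M where
  taxi := fun i => Taxi.at (C i)
  active := 0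

/-- The real movement upon the request `r`. -/
def move (R : StopRule M) (S : BiasedState M) (r : Request M) : Move M 2 where
  target := fun i => (S.approach R r.1 i).pos
  server := S.first r.1

theorem move_serves (R : StopRule M) (S : BiasedState M) (r : Request M) :
    (S.move R r).Serves r := by
  have hne : S.passive ≠ S.active := by
    unfold passive
    generalize S.active = a
    revert a
    decide
  have key : ∀ i, (if i = S.active then S.time r.1 else 2 * S.time r.1) = (S.taxi i).loc r.1 →
      (S.approach R r.1 i).pos = r.1 := by
    intro i hi
    simp only [approach, Taxi.advance, hi, if_true, Taxi.at]
  refine key (S.first r.1) ?_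
  by_cases h : (S.taxi S.passive).loc r.1 / 2 ≤ (S.taxi S.active).loc r.1
  · simp only [first, if_pos h, if_neg hne, time, min_eq_right h]
    ring
  · simp only [first, if_neg h, if_true, time, min_eq_left (not_le.mp h).le]

end BiasedState

/-- The algorithm BiasedDC for two taxis. -/
def biasedDC {M : Type u} [MetricSpace M] (R : StopRule M) : OnlineAlgorithm M 2 where
  move := fun C past r => (past.foldl (BiasedState.next R) (BiasedState.init C)).move R r
  serves := fun _ _ _ => BiasedState.move_serves R _ _

end HardTaxi

end

/-! Upper bound: between requests an offline taxi may be assumed to stand with the active taxi of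
BiasedDC, at the last destination, so only the distance between the passive taxi and the other
offline taxi `y` matters. The potential is three times this distance plus the passive taxi's
postponed driving. `BiasedState.step` shows that each request raises cost plus potential by at most
9 times the offline cost.

Lower bound: on a line, requests can keep two offline histories alive, with the second taxi at one
of two places `e` and `f` (`SearchPosition`). The online algorithm has to decide where its own
second taxi is, which is the classical search on a line with ratio 9. `search_game` excludes every
smaller ratio: the longer path, measured against the accumulated cost, would shrink by a fixed
amount at each turn. -/

namespace HardTaxi

/-! ### Schedules and configurations of two taxis -/

section Schedules

variable {M : Type u}

/-- The two taxis are at `a` and `b`, in some order. -/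
def Occupies (C : Config M 2) (a b : M) : Prop :=
  (C 0 = a ∧ C 1 = b) ∨ (C 0 = b ∧ C 1 = a)

theorem Occupies.symm {C : Config M 2} {a b : M} (h : Occupies C a b) : Occupies C b a :=
  Or.symm h

/-- The configuration reached by serving `σ` with the given moves. -/
def finalConfig {k : ℕ} : Config M k → List (Request M) → List (Move M k) → Config M k
  | _, r :: σ, m :: ms => finalConfig (m.after r) σ ms
  | C, _, _ => C

theorem finalConfig_append {k : ℕ} (τ : List (Request M)) (ns : List (Move M k)) :
    ∀ (C : Config M k) (σ : List (Request M)) (ms : List (Move M k)), ms.length = σ.length →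
      finalConfig C (σ ++ τ) (ms ++ ns) = finalConfig (finalConfig C σ ms) τ ns
  | _, [], [], _ => by simp [finalConfig]
  | _, r :: σ, m :: ms, h => by
    simpa [finalConfig] using finalConfig_append τ ns (m.after r) σ ms (by simpa using h)

/-- Needed to bound `opt` from below: the infimum of an empty set would be 0. -/
theorem exists_schedule (σ : List (Request M)) :
    ∃ ms : List (Move M 2), List.Forall₂ Move.Serves ms σ := by
  induction σ with
  | nil => exact ⟨[], .nil⟩
  | cons r σ ih =>
    obtain ⟨ms, h⟩ := ih
    exact ⟨⟨fun _ => r.1, 0⟩ :: ms, .cons rfl h⟩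

variable [MetricSpace M]

theorem scheduleCost_append {k : ℕ} (τ : List (Request M)) (ns : List (Move M k)) :
    ∀ (C : Config M k) (σ : List (Request M)) (ms : List (Move M k)), ms.length = σ.length →
      scheduleCost C (σ ++ τ) (ms ++ ns) =
        scheduleCost C σ ms + scheduleCost (finalConfig C σ ms) τ ns
  | _, [], [], _ => by simp [finalConfig, scheduleCost]
  | _, r :: σ, m :: ms, h => by
    simp [finalConfig, scheduleCost, scheduleCost_append τ ns (m.after r) σ ms (by simpa using h),
      add_assoc]

theorem scheduleCost_nonneg {k : ℕ} :
    ∀ (C : Config M k) (σ : List (Request M)) (ms : List (Move M k)), 0 ≤ scheduleCost C σ ms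
  | _, [], _ => by simp [scheduleCost]
  | _, _ :: _, [] => by simp [scheduleCost]
  | C, r :: σ, m :: ms => by
    have := scheduleCost_nonneg (m.after r) σ ms
    simp only [scheduleCost]
    positivity

theorem opt_le {k : ℕ} {C : Config M k} {σ : List (Request M)} {ms : List (Move M k)}
    (h : List.Forall₂ Move.Serves ms σ) : opt C σ ≤ scheduleCost C σ ms :=
  csInf_le ⟨0, by rintro x ⟨ms, -, rfl⟩; exact scheduleCost_nonneg _ _ _⟩ ⟨ms, h, rfl⟩

/-- The effect of a move upon a request on two taxis at `a` and `y`: one of the two serves, and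
the other one drives to some point `y'`. -/
theorem Occupies.of_serves {C : Config M 2} {a y : M} (h : Occupies C a y) {m : Move M 2}
    {r : Request M} (hm : m.Serves r) :
    ∃ y', Occupies (m.after r) r.2 y' ∧
      (∑ i, dist (C i) (m.target i) = dist a r.1 + dist y y' ∨
        ∑ i, dist (C i) (m.target i) = dist y r.1 + dist a y') := by
  obtain ⟨target, server⟩ := m
  simp only [Move.Serves] at hm
  fin_cases server
  · refine ⟨target 1, Or.inl ⟨by simp [Move.after], by simp [Move.after]⟩, ?_⟩
    rcases h with ⟨rfl, rfl⟩ | ⟨rfl, rfl⟩ <;> simp_all [Fin.sum_univ_two]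
  · refine ⟨target 0, Or.inr ⟨by simp [Move.after], by simp [Move.after]⟩, ?_⟩
    rcases h with ⟨rfl, rfl⟩ | ⟨rfl, rfl⟩ <;> simp_all [Fin.sum_univ_two, add_comm]

/-- The taxi at `a` can serve a request while the other one stays. -/
theorem Occupies.exists_move {C : Config M 2} {a y : M} (h : Occupies C a y) (r : Request M) :
    ∃ m : Move M 2, m.Serves r ∧ Occupies (m.after r) r.2 y ∧
      ∑ i, dist (C i) (m.target i) = dist a r.1 := by
  rcases h with ⟨rfl, rfl⟩ | ⟨rfl, rfl⟩
  · exact ⟨⟨Function.update C 0 r.1, 0⟩, by simp [Move.Serves], Or.inl (by simp [Move.after]),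
      by simp [Fin.sum_univ_two]⟩
  · exact ⟨⟨Function.update C 1 r.1, 1⟩, by simp [Move.Serves], Or.inr (by simp [Move.after]),
      by simp [Fin.sum_univ_two]⟩

end Schedules

/-! ### Upper bound: the potential argument for BiasedDC -/

section UpperBound

variable {M : Type u} [MetricSpace M]

/-- `f` gives the distances from a point of a metric extension of `M`. -/
structure IsPlace (f : M → ℝ) : Prop where
  le_add : ∀ x y, f x ≤ f y + dist x y
  dist_le : ∀ x y, dist x y ≤ f x + f y

theorem IsPlace.nonneg {f : M → ℝ} (h : IsPlace f) (x : M) : 0 ≤ f x := by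
  have := h.dist_le x x
  rw [dist_self] at this
  linarith

theorem isPlace_dist (x : M) : IsPlace (dist x) :=
  ⟨fun y z => by rw [dist_comm y z]; exact dist_triangle _ _ _,
    fun y z => dist_triangle_left _ _ _⟩

theorem IsPlace.virtualPoint {f : M → ℝ} (h : IsPlace f) {s : M} {r : ℝ} (hr : 0 ≤ r)
    (hrs : r ≤ f s) : IsPlace (virtualPoint f s r) := by
  refine ⟨fun x y => ?_, fun x y => ?_⟩
  · have h₁ := h.le_add x y
    have h₂ := dist_triangle s y x
    rw [dist_comm y x] at h₂
    unfold HardTaxi.virtualPoint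
    rw [← min_add_add_right]
    exact min_le_min (by linarith) (by linarith)
  · have h₁ := h.dist_le x y
    have h₂ := dist_triangle_left x y s
    have h₃ := h.dist_le x s
    have h₄ := h.dist_le s y
    have h₅ := dist_triangle x s y
    rw [dist_comm x s] at *
    unfold HardTaxi.virtualPoint
    rcases min_cases (r + f x) (f s - r + dist s x) with ⟨e, -⟩ | ⟨e, -⟩ <;>
    rcases min_cases (r + f y) (f s - r + dist s y) with ⟨e', -⟩ | ⟨e', -⟩ <;>
    rw [e, e'] <;> linarith

/-- A taxi that has advanced by `r` towards `s`; it has really driven at most `r`, up to the change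
of the distance between its position and its pretended place. -/
theorem Taxi.advance_spec (R : StopRule M) {T : Taxi M} (hT : IsPlace T.loc) {s : M} {r : ℝ}
    (hr : 0 ≤ r) (hrs : r ≤ T.loc s) :
    IsPlace (T.advance R s r).loc ∧
      (∀ x, (T.advance R s r).loc x ≤ r + T.loc x) ∧
      (∀ x, (T.advance R s r).loc x ≤ T.loc s - r + dist s x) ∧
      dist T.pos (T.advance R s r).pos + (T.advance R s r).loc (T.advance R s r).pos ≤
        T.loc T.pos + r := by
  unfold Taxi.advance
  split_ifs with h
  · refine ⟨isPlace_dist s, fun x => ?_, fun x => ?_, ?_⟩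
    · rw [h]; exact hT.dist_le s x
    · simp [Taxi.at, h]
    · simp only [Taxi.at, dist_self, add_zero, h]; exact hT.dist_le _ _
  · split
    · rename_i z hz
      obtain ⟨h₁, h₂⟩ := R.on_path _ _ _ _ hz
      refine ⟨isPlace_dist z, fun x => ?_, fun x => ?_, ?_⟩
      · rw [← h₁]; exact hT.dist_le z x
      · rw [← h₂]; exact dist_triangle _ _ _
      · simp only [Taxi.at, dist_self, add_zero]
        rw [← h₁]; exact hT.dist_le _ _
    · refine ⟨hT.virtualPoint hr hrs, fun x => min_le_left _ _, fun x => min_le_right _ _, ?_⟩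
      simp only [dist_self, zero_add]
      exact (min_le_left _ _).trans_eq (add_comm _ _)

namespace BiasedState

omit [MetricSpace M] in
theorem passive_ne_active (S : BiasedState M) : S.passive ≠ S.active := by
  unfold passive
  generalize S.active = a
  revert a
  decide

omit [MetricSpace M] in
theorem sum_eq (S : BiasedState M) (g : Fin 2 → ℝ) : ∑ i, g i = g S.active + g S.passive := by
  unfold passive
  generalize S.active = a
  fin_cases a <;> simp [Fin.sum_univ_two, add_comm]

/-- The active taxi really is at `a`, and the passive one pretends to be at a place. -/
structure Valid (S : BiasedState M) (a : M) : Prop where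
  active_eq : S.taxi S.active = Taxi.at a
  isPlace : IsPlace (S.taxi S.passive).loc

/-- The real positions of the taxis. -/
def config (S : BiasedState M) : Config M 2 := fun i => (S.taxi i).pos

theorem move_after (R : StopRule M) (S : BiasedState M) (r : Request M) :
    (S.move R r).after r = (S.next R r).config := by
  funext i
  by_cases h : i = S.first r.1
  · subst h; simp [Move.after, move, next, config, Taxi.at]
  · simp [Move.after, move, next, config, h]

/-- The moves upon the requests of a list. -/
noncomputable def moves (R : StopRule M) : BiasedState M → List (Request M) → List (Move M 2)
  | _, [] => []
  | S, r :: σ => S.move R r :: moves R (S.next R r) σ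

/-- The potential: three times the distance between the passive taxi and the offline taxi that is
not at the place of the active one, plus what the passive taxi only pretends to have moved. -/
noncomputable def potential (S : BiasedState M) (y : M) : ℝ :=
  3 * (S.taxi S.passive).loc y + (S.taxi S.passive).loc (S.taxi S.passive).pos

theorem potential_nonneg {S : BiasedState M} {a : M} (hS : S.Valid a) (y : M) :
    0 ≤ S.potential y := by
  have h₁ := hS.isPlace.nonneg y
  have h₂ := hS.isPlace.nonneg (S.taxi S.passive).pos
  unfold potential
  positivity

/-- Online cost and postponed driving together grow by at most `3 * S.time s`. The two alternatives
for `x` say which offline taxi serves; the speeds 1 and 2 balance the resulting cases, and the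
factor 9 is needed only when the offline taxi at `a` serves. -/
theorem step (R : StopRule M) {S : BiasedState M} {a : M} (hS : S.Valid a) (y y' : M)
    (r : Request M) {x : ℝ}
    (hx : x = dist a r.1 + dist y y' ∨ x = dist y r.1 + dist a y') :
    (S.next R r).Valid r.2 ∧
      ∑ i, dist (S.config i) ((S.move R r).target i) + (S.next R r).potential y' ≤
        9 * x + S.potential y := by
  obtain ⟨s, t⟩ := r
  have hne := S.passive_ne_active
  have hf := hS.isPlace
  have hA := hS.active_eq
  have hAloc : (S.taxi S.active).loc = dist a := by rw [hA]; rfl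
  have hApos : (S.taxi S.active).pos = a := by rw [hA]; rfl
  have hτa : S.time s ≤ dist a s := by
    rw [← hAloc]; exact min_le_left _ _
  have hτp : 2 * S.time s ≤ (S.taxi S.passive).loc s := by
    have : S.time s ≤ (S.taxi S.passive).loc s / 2 := min_le_right _ _
    linarith
  have hτ : 0 ≤ S.time s := by
    refine le_min ?_ ?_
    · rw [hAloc]; exact dist_nonneg
    · have := hf.nonneg s; positivity
  obtain ⟨ha₁, ha₂, ha₃, ha₄⟩ := Taxi.advance_spec R (T := S.taxi S.active)
    (by rw [hAloc]; exact isPlace_dist a) hτ (by rw [hAloc]; exact hτa)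
  obtain ⟨hp₁, hp₂, hp₃, hp₄⟩ := Taxi.advance_spec R hf (by positivity) hτp
  have hapa : S.approach R s S.active = (S.taxi S.active).advance R s (S.time s) := by
    simp [approach]
  have happ : S.approach R s S.passive = (S.taxi S.passive).advance R s (2 * S.time s) := by
    simp [approach, hne]
  rw [sum_eq S]
  simp only [config, move, hapa, happ]
  have hpass : S.first s = S.passive → (S.next R (s, t)).passive = S.active := by
    intro h
    simp only [passive, next] at h ⊢
    rw [h]; simp
  have hact : S.first s = S.active → (S.next R (s, t)).passive = S.passive := by
    intro h
    simp only [passive, next] at h ⊢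
    rw [h]
  have hd₁ := hf.dist_le s y
  have hd₂ := hf.le_add s y
  have hd₃ := hf.le_add y' y
  have hd₄ := dist_triangle s y y'
  have hd₅ := dist_triangle s a y'
  rw [dist_comm s y] at *
  rw [dist_comm s a] at *
  rw [dist_comm y' y] at *
  have hn₁ := dist_nonneg (x := y) (y := s)
  have hn₂ := dist_nonneg (x := y) (y := y')
  have hn₃ := dist_nonneg (x := a) (y := y')
  by_cases hc : (S.taxi S.passive).loc s / 2 ≤ (S.taxi S.active).loc s
  · have hfirst : S.first s = S.passive := by simp [first, hc]
    have htime : 2 * S.time s = (S.taxi S.passive).loc s := by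
      rw [time, min_eq_right hc]; ring
    have hnext : (S.next R (s, t)).taxi S.active = (S.taxi S.active).advance R s (S.time s) := by
      simp [next, hfirst, hne.symm, hapa]
    refine ⟨⟨by simp [next], ?_⟩, ?_⟩
    · rw [hpass hfirst, hnext]; exact ha₁
    · unfold potential
      rw [hpass hfirst, hnext]
      -- The former active taxi is now passive. If the offline taxi at `a` serves, its distance to
      -- `y'` is bounded through `s` (`h₃`), otherwise through `a` (`h₂`).
      have h₂ := ha₂ y'
      have h₃ := ha₃ y'
      have h₄ := hp₁.nonneg ((S.taxi S.passive).advance R s (2 * S.time s)).pos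
      rw [hAloc] at h₂ h₃ ha₄
      rw [hApos] at ha₄ ⊢
      rw [dist_self] at ha₄
      rcases hx with rfl | rfl <;> linarith
  · have hfirst : S.first s = S.active := by simp [first, hc]
    have htime : S.time s = dist a s := by
      rw [time, min_eq_left (not_le.mp hc).le, hAloc]
    have hnext : (S.next R (s, t)).taxi S.passive =
        (S.taxi S.passive).advance R s (2 * S.time s) := by
      simp [next, hfirst, hne, happ]
    refine ⟨⟨by simp [next], ?_⟩, ?_⟩
    · rw [hact hfirst, hnext]; exact hp₁
    · unfold potential
      rw [hact hfirst, hnext]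
      -- The passive taxi moved `2 * dist a s`. If the offline taxi at `a` serves, this may lead
      -- away from `y'` (`h₂`): 3 for driving plus 6 for the potential give 9. Otherwise the
      -- progress towards `s` (`h₃`) pays for the driving.
      have h₂ := hp₂ y'
      have h₃ := hp₃ y'
      have h₄ := ha₁.nonneg ((S.taxi S.active).advance R s (S.time s)).pos
      rw [hAloc] at ha₄
      rw [hApos] at ha₄ ⊢
      rw [dist_self] at ha₄
      rcases hx with rfl | rfl <;> linarith

theorem scheduleCost_moves_le (R : StopRule M) (σ : List (Request M)) :
    ∀ (S : BiasedState M) (a y : M) (D : Config M 2) (ms : List (Move M 2)), S.Valid a →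
      Occupies D a y → List.Forall₂ Move.Serves ms σ →
      scheduleCost S.config σ (S.moves R σ) ≤ 9 * scheduleCost D σ ms + S.potential y := by
  induction σ with
  | nil =>
    intro S a y D ms hS _ _
    simpa [scheduleCost] using potential_nonneg hS y
  | cons r σ ih =>
    intro S a y D ms hS hD hms
    obtain _ | ⟨hm, hms⟩ := hms
    obtain ⟨y', hD', hx⟩ := hD.of_serves hm
    obtain ⟨hS', hle⟩ := step R hS y y' r hx
    have := ih _ _ _ _ _ hS' hD' hms
    simp only [moves, scheduleCost, move_after]
    linarith

end BiasedState

theorem movesFrom_biasedDC (R : StopRule M) (C : Config M 2) (σ : List (Request M)) :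
    ∀ past, (biasedDC R).movesFrom C past σ =
      (past.foldl (BiasedState.next R) (BiasedState.init C)).moves R σ := by
  induction σ with
  | nil => intro past; rfl
  | cons r σ ih =>
    intro past
    rw [OnlineAlgorithm.movesFrom, BiasedState.moves, ih, List.foldl_append]
    rfl

theorem biasedDC_isCompetitive (R : StopRule M) : (biasedDC R).IsCompetitive 9 := by
  intro C
  -- No additive constant is needed, since the initial potential vanishes.
  refine ⟨0, fun σ => ?_⟩
  have hle : (biasedDC R).cost C σ / 9 ≤ opt C σ := by
    refine le_csInf ?_ ?_
    · obtain ⟨ms, h⟩ := exists_schedule σ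
      exact ⟨_, ms, h, rfl⟩
    · rintro _ ⟨ms, hms, rfl⟩
      have hv : (BiasedState.init C).Valid (C 0) := ⟨rfl, isPlace_dist _⟩
      have := BiasedState.scheduleCost_moves_le R σ _ _ (C 1) C ms hv (Or.inl ⟨rfl, rfl⟩) hms
      have hp : (BiasedState.init C).potential (C 1) = 0 := by
        simp [BiasedState.potential, BiasedState.init, BiasedState.passive, Taxi.at]
      rw [hp] at this
      have hc : (biasedDC R).cost C σ =
          scheduleCost (BiasedState.init C).config σ ((BiasedState.init C).moves R σ) := by
        rw [OnlineAlgorithm.cost, movesFrom_biasedDC]; rfl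
      rw [hc]
      linarith
  linarith

end UpperBound

/-! ### Lower bound: searching two growing paths -/

section LowerBound

/-- A search game on two paths. The searcher, who has paid `c`, is at the end of the path of length
`E`, and the other path has length `F`. When the path of length `E` grows by one, the searcher
pays one to follow or `E + F` to go to the end of the other path. For `ρ < 9`, the cost cannot stay
below `ρ` times both lengths plus a constant. -/
theorem search_game {P : ℝ → ℝ → ℝ → Prop} {ρ K : ℝ} (hρ : ρ < 9) (h₀ : P 0 0 0)
    (hP : ∀ c E F, P c E F → P (c + 1) (E + 1) F ∨ P (c + E + F) F (E + 1))
    (hE : ∀ c E F, P c E F → c ≤ ρ * E + K) (hF : ∀ c E F, P c E F → c ≤ ρ * F + K) : False := by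
  -- The searcher must turn eventually: following forever raises the cost while `F` stays fixed.
  have switch : ∀ c E F, P c E F → ∃ E', E ≤ E' ∧ P (c - E + 2 * E' + F) F (E' + 1) := by
    intro c E F h
    by_contra! hno
    have hstay : ∀ n : ℕ, P (c + n) (E + n) F := by
      intro n
      induction n with
      | zero => simpa using h
      | succ n ih =>
        rcases hP _ _ _ ih with h' | h'
        · push_cast; rwa [← add_assoc, ← add_assoc]
        · refine absurd ?_ (hno (E + n) (by simp))
          convert h' using 1
          ring
    obtain ⟨n, hn⟩ := exists_nat_gt (ρ * F + K - c)
    have := hF _ _ _ (hstay n)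
    linarith
  /- `D = c - K - E` does not change while the searcher follows. -/
  have switch' : ∀ D E F, P (D + K + E) E F →
      ∃ E', E ≤ E' ∧ P (D + 2 * E' + K + F) F (E' + 1) ∧ D + 2 * E' ≤ (ρ - 1) * F := by
    intro D E F h
    obtain ⟨E', hEE', h'⟩ := switch _ _ _ h
    have h' : P (D + 2 * E' + K + F) F (E' + 1) := by
      convert h' using 1
      ring
    exact ⟨E', hEE', h', by linarith [hE _ _ _ h']⟩
  have large : ∀ n : ℕ, ∃ D E F, P (D + K + E) E F ∧ 1 ≤ E ∧ 1 ≤ F ∧ n - K ≤ D := by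
    intro n
    induction n with
    | zero =>
      -- Two turns make both lengths at least 1; from then on every turn increases `D` by at least
      -- 2.
      obtain ⟨E₁, hE₁, h₁, -⟩ := switch' (-K) 0 0 (by simpa using h₀)
      obtain ⟨E₂, hE₂, h₂, -⟩ := switch' _ _ _ h₁
      exact ⟨_, _, _, h₂, by linarith, by linarith, by push_cast; linarith⟩
    | succ n ih =>
      obtain ⟨D, E, F, h, hE1, hF1, hD⟩ := ih
      obtain ⟨E', hE', h', -⟩ := switch' _ _ _ h
      exact ⟨_, _, _, h', hF1, by linarith, by push_cast; linarith⟩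
  set B := ρ - 1 with hB
  set η := (8 - B) / 64 with hη
  have hη0 : 0 < η := by rw [hη]; linarith
  -- The bound `l` on `F / D` drops by `η` per turn. A turn replaces it by at most `1/2 - 1/(2Bl) +
  -- η`, where the last `η` absorbs the unit in `E₂ + 1` because `1 ≤ η * D₂`.
  have ratio : ∃ l : ℝ, ∀ n : ℕ, ∃ D E F, P (D + K + E) E F ∧ 1 ≤ E ∧ 1 ≤ F ∧ 0 < D ∧
      1 ≤ η * D ∧ F ≤ (l - n * η) * D := by
    obtain ⟨m, hm⟩ := exists_nat_gt (1 / η + K)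
    obtain ⟨D, E, F, h, hE1, hF1, hD⟩ := large m
    have hDη : 1 / η ≤ D := by linarith
    have hD0 : 0 < D := lt_of_lt_of_le (by positivity) hDη
    refine ⟨F / D, fun n => ?_⟩
    induction n with
    | zero =>
      refine ⟨D, E, F, h, hE1, hF1, hD0, ?_, ?_⟩
      · rwa [div_le_iff₀' hη0] at hDη
      · rw [Nat.cast_zero, zero_mul, sub_zero, div_mul_cancel₀ _ hD0.ne']
    | succ n ih =>
      clear h hE1 hF1 hD hDη
      obtain ⟨D₁, E₁, F₁, h, hE1, hF1, hD₁, hDη, hFD⟩ := ih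
      set l := F / D - n * η with hl
      obtain ⟨E₂, hE₂, h₂, hle⟩ := switch' _ _ _ h
      set D₂ := D₁ + 2 * E₂ with hD₂
      have hD₂0 : 0 < D₂ := by linarith
      refine ⟨D₂, F₁, E₂ + 1, h₂, hF1, by linarith, hD₂0, by nlinarith, ?_⟩
      have hl0 : 0 < l := pos_of_mul_pos_left (by linarith) hD₁.le
      have hB0 : 0 < B := pos_of_mul_pos_left (hD₂0.trans_le hle) (by linarith)
      have hD₁D₂ : D₂ / (B * l) ≤ D₁ := by
        rw [div_le_iff₀ (by positivity)]
        nlinarith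
      -- By the inequality of arithmetic and geometric means the right side is at least `√(2/B)`,
      -- which exceeds `1/2` exactly when `B < 8`, that is, `ρ < 9`.
      have hgap : 1 / 2 + 2 * η ≤ l + 1 / (2 * (B * l)) := by
        -- The discriminant condition for `hq`. With `B = 8 - 64 * η` the terms linear in `η` cancel
        -- and the others are negative.
        have hd : B * (1 + 4 * η) ^ 2 ≤ 8 := by
          have : B = 8 - 64 * η := by rw [hη]; ring
          rw [this]
          nlinarith [pow_pos hη0 3, pow_pos hη0 2]
        have hq : 0 ≤ 2 * B * l ^ 2 - B * l * (1 + 4 * η) + 1 := by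
          nlinarith [mul_nonneg hB0.le (sq_nonneg (4 * l - (1 + 4 * η)))]
        have : l + 1 / (2 * (B * l)) - (1 / 2 + 2 * η) =
            (2 * B * l ^ 2 - B * l * (1 + 4 * η) + 1) / (2 * (B * l)) := by
          field_simp
          ring
        have := div_nonneg hq (by positivity : (0 : ℝ) ≤ 2 * (B * l))
        linarith
      have hη₂ : 1 ≤ η * D₂ := by nlinarith
      have hmul := mul_le_mul_of_nonneg_right hgap hD₂0.le
      have : (l + 1 / (2 * (B * l))) * D₂ = l * D₂ + D₂ / (B * l) / 2 := by
        field_simp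
      have hl' : F / D - ((n + 1 : ℕ) : ℝ) * η = l - η := by
        rw [hl]; push_cast; ring
      rw [hl']
      linarith
  obtain ⟨l, hl⟩ := ratio
  obtain ⟨n, hn⟩ := exists_nat_gt (l / η)
  obtain ⟨D, E, F, -, -, hF1, hD, -, hFD⟩ := hl n
  rw [div_lt_iff₀ hη0] at hn
  nlinarith

/-! ### Appending a request to a play of an online algorithm -/

namespace OnlineAlgorithm

variable {M : Type u} {k : ℕ} (A : OnlineAlgorithm M k) (C : Config M k)

theorem length_movesFrom (σ : List (Request M)) :
    ∀ past, (A.movesFrom C past σ).length = σ.length := by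
  induction σ with
  | nil => intro past; rfl
  | cons r σ ih => intro past; simp [movesFrom, ih]

theorem movesFrom_concat (r : Request M) (σ : List (Request M)) :
    ∀ past, A.movesFrom C past (σ ++ [r]) = A.movesFrom C past σ ++ [A.move C (past ++ σ) r] := by
  induction σ with
  | nil => intro past; simp [movesFrom]
  | cons q σ ih => intro past; simp [movesFrom, ih]

/-- The configuration of `A` after serving `σ`. -/
def configAfter (σ : List (Request M)) : Config M k := finalConfig C σ (A.movesFrom C [] σ)

theorem configAfter_concat (σ : List (Request M)) (r : Request M) :
    A.configAfter C (σ ++ [r]) = (A.move C σ r).after r := by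
  rw [configAfter, movesFrom_concat, finalConfig_append _ _ _ _ _ (A.length_movesFrom C σ _)]
  simp [finalConfig]

theorem cost_concat [MetricSpace M] (σ : List (Request M)) (r : Request M) :
    A.cost C (σ ++ [r]) =
      A.cost C σ + ∑ i, dist (A.configAfter C σ i) ((A.move C σ r).target i) := by
  rw [cost, movesFrom_concat, scheduleCost_append _ _ _ _ _ (A.length_movesFrom C σ _)]
  simp [scheduleCost, cost, configAfter]

end OnlineAlgorithm

/-! ### The adversary -/

variable {M : Type u} [MetricSpace M]

theorem OnlineAlgorithm.occupies_concat (A : OnlineAlgorithm M 2) {C : Config M 2}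
    {σ : List (Request M)} {a z : M} (h : Occupies (A.configAfter C σ) a z) (r : Request M) :
    ∃ z', Occupies (A.configAfter C (σ ++ [r])) r.2 z' ∧
      (A.cost C (σ ++ [r]) = A.cost C σ + (dist a r.1 + dist z z') ∨
        A.cost C (σ ++ [r]) = A.cost C σ + (dist z r.1 + dist a z')) := by
  rw [configAfter_concat, cost_concat]
  obtain ⟨z', h', hc⟩ := h.of_serves (A.serves C σ r)
  exact ⟨z', h', hc.imp (fun e => by rw [e]) (fun e => by rw [e])⟩

/-- Offline, `σ` can be served at cost at most `v` such that taxis are at `a` and `x` afterwards. -/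
def Reachable (C : Config M 2) (σ : List (Request M)) (a x : M) (v : ℝ) : Prop :=
  ∃ ms : List (Move M 2), List.Forall₂ Move.Serves ms σ ∧ scheduleCost C σ ms ≤ v ∧
    Occupies (finalConfig C σ ms) a x

namespace Reachable

variable {C : Config M 2} {σ : List (Request M)} {a x : M} {v : ℝ}

theorem symm (h : Reachable C σ a x v) : Reachable C σ x a v := by
  obtain ⟨ms, h₁, h₂, h₃⟩ := h
  exact ⟨ms, h₁, h₂, h₃.symm⟩

theorem opt_le (h : Reachable C σ a x v) : opt C σ ≤ v := by
  obtain ⟨ms, h₁, h₂, -⟩ := h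
  exact (HardTaxi.opt_le h₁).trans h₂

theorem concat (h : Reachable C σ a x v) (r : Request M) :
    Reachable C (σ ++ [r]) r.2 x (v + dist a r.1) := by
  obtain ⟨ms, h₁, h₂, h₃⟩ := h
  obtain ⟨m, hm, ho, hd⟩ := h₃.exists_move r
  refine ⟨ms ++ [m], List.rel_append h₁ (.cons hm .nil), ?_, ?_⟩
  · rw [scheduleCost_append _ _ _ _ _ h₁.length_eq]
    simp only [scheduleCost, hd]
    linarith
  · rw [finalConfig_append _ _ _ _ _ h₁.length_eq]
    exact ho

end Reachable

/-- A position of the search game in a play against `A`: a taxi is at `a`, and the other one could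
be at `e` at offline cost `E` or at `f` at offline cost `F`. The other taxi of `A` is at `z`, but is
accounted for as if it stayed at `e` after the cost `c`. -/
def SearchPosition (A : OnlineAlgorithm M 2) (C : Config M 2) (c E F : ℝ) : Prop :=
  ∃ (σ : List (Request M)) (a e f z : M), Occupies (A.configAfter C σ) a z ∧
    dist e f = E + F ∧ c + dist e z ≤ A.cost C σ ∧ Reachable C σ a e E ∧ Reachable C σ a f F

namespace SearchPosition

variable {A : OnlineAlgorithm M 2} {C : Config M 2} {c E F ρ K : ℝ}

/-- The adversary prolongs the segment from `e` to `f` by one to `t` and requests `(a, t)`, then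
`(f, t)`. An offline taxi at `f` serves the latter for free and ends at `t`; with the other taxi at
`e`, the one at `t` drives back to `f` at cost 1. -/
theorem step (hM : ∀ x y : M, ∃ t, dist y t = 1 ∧ dist x t = dist x y + 1)
    (h : SearchPosition A C c E F) :
    SearchPosition A C (c + 1) (E + 1) F ∨ SearchPosition A C (c + E + F) F (E + 1) := by
  obtain ⟨σ, a, e, f, z, ho, hd, hc, he, hf⟩ := h
  obtain ⟨t, hft, het⟩ := hM e f
  have he₁ := he.concat (a, t)
  have hf₁ := hf.concat (a, t)
  obtain ⟨z₁, ho₁, hc₁⟩ := A.occupies_concat ho (a, t)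
  have he₂ := he₁.concat (f, t)
  have hf₂ := hf₁.symm.concat (f, t)
  obtain ⟨z₂, ho₂, hc₂⟩ := A.occupies_concat ho₁ (f, t)
  simp only [dist_self, add_zero, zero_add] at he₁ hf₁ he₂ hf₂ hc₁ hc₂ ho₁ ho₂
  rw [dist_comm t f, hft] at he₂ hc₂
  -- Whichever taxi serves `(a, t)`, the algorithm pays at least `dist z z₁`.
  have hez : c + dist e z₁ ≤ A.cost C (σ ++ [(a, t)]) := by
    have h₁ := dist_triangle e z z₁
    have h₂ := dist_triangle z a z₁
    rcases hc₁ with h | h <;> linarith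
  -- Serving from `t` means following at cost 1. Serving with the other taxi means crossing from `e`
  -- to `f`, after which `t` and `e` become the new `e` and `f`.
  rcases hc₂ with h | h
  · refine Or.inl ⟨_, _, e, t, z₂, ho₂, by linarith, ?_, he₂, hf₂⟩
    have := dist_triangle e z₁ z₂
    linarith
  · refine Or.inr ⟨_, _, t, e, z₂, ho₂, by rw [dist_comm]; linarith, ?_, hf₂, he₂⟩
    have := dist_triangle e z₁ f
    linarith

theorem le (hρ : 0 ≤ ρ) (hK : ∀ σ, A.cost C σ ≤ ρ * opt C σ + K) (h : SearchPosition A C c E F) :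
    c ≤ ρ * E + K ∧ c ≤ ρ * F + K := by
  obtain ⟨σ, a, e, f, z, -, -, hc, he, hf⟩ := h
  have h₁ := hK σ
  have h₂ := mul_le_mul_of_nonneg_left he.opt_le hρ
  have h₃ := mul_le_mul_of_nonneg_left hf.opt_le hρ
  have h₄ := dist_nonneg (x := e) (y := z)
  constructor <;> linarith

end SearchPosition

theorem OnlineAlgorithm.IsCompetitive.mono {k : ℕ} {A : OnlineAlgorithm M k} {ρ ρ' : ℝ}
    (h : A.IsCompetitive ρ) (hρ : ρ ≤ ρ') : A.IsCompetitive ρ' := by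
  intro C
  obtain ⟨c, hc⟩ := h C
  refine ⟨c, fun σ => (hc σ).trans ?_⟩
  have : 0 ≤ opt C σ := Real.sInf_nonneg (by
    rintro x ⟨ms, -, rfl⟩
    exact scheduleCost_nonneg _ _ _)
  gcongr

/-- No deterministic online algorithm is better than `9`-competitive on a metric space in which
every segment can be prolonged by one. -/
theorem OnlineAlgorithm.IsCompetitive.nine_le [Nonempty M]
    (hM : ∀ x y : M, ∃ t, dist y t = 1 ∧ dist x t = dist x y + 1) {A : OnlineAlgorithm M 2} {ρ : ℝ}
    (hA : A.IsCompetitive ρ) : 9 ≤ ρ := by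
  by_contra! hlt
  obtain ⟨o⟩ := ‹Nonempty M›
  let C : Config M 2 := fun _ => o
  -- A nonnegative ratio is needed to pass from `opt` to the offline costs `E` and `F`.
  obtain ⟨K, hK⟩ := hA.mono (le_max_left ρ 0) C
  refine search_game (P := SearchPosition A C) (max_lt hlt (by norm_num)) ?_
    (fun _ _ _ h => h.step hM) (fun _ _ _ h => (h.le (le_max_right ρ 0) hK).1)
    (fun _ _ _ h => (h.le (le_max_right ρ 0) hK).2)
  have hr : Reachable C [] o o 0 := ⟨[], .nil, by simp [scheduleCost], Or.inl ⟨rfl, rfl⟩⟩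
  exact ⟨[], o, o, o, o, Or.inl ⟨rfl, rfl⟩, by simp,
    by simp [cost, scheduleCost], hr, hr⟩

theorem exists_prolongation (x y : ULift.{u} ℝ) :
    ∃ t, dist y t = 1 ∧ dist x t = dist x y + 1 := by
  obtain ⟨x⟩ := x
  obtain ⟨y⟩ := y
  simp only [ULift.dist_eq, ULift.exists, Real.dist_eq]
  rcases le_total x y with h | h
  · refine ⟨y + 1, by simp, ?_⟩
    rw [abs_of_nonpos (by linarith), abs_of_nonpos (by linarith)]
    ring
  · refine ⟨y - 1, by simp, ?_⟩
    rw [abs_of_nonneg (by linarith), abs_of_nonneg (by linarith)]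
    ring

end LowerBound

end HardTaxi

theorem theorem4 :
    (∀ (M : Type u) [MetricSpace M] (R : HardTaxi.StopRule M),
      (HardTaxi.biasedDC R).IsCompetitive 9) ∧
    HardTaxi.IsCompetitiveRatio.{u} 2 9 := by
  refine ⟨fun M _ R => HardTaxi.biasedDC_isCompetitive R, fun ρ hρ => ?_, fun b hb => ?_⟩
  · obtain ⟨A, hA⟩ := hρ (ULift.{u} ℝ)
    exact hA.nine_le HardTaxi.exists_prolongation
  · exact hb fun M _ => ⟨_, HardTaxi.biasedDC_isCompetitive default⟩
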